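/- Let $p$ be a prime with $p \equiv 1 \pmod 8$ and $p \equiv \pm 1 \pmod 5$. Then $p = x^2 + y^2$ for some integers $x, y$, and this decomposition is unique up to the order and the signs of $x$ and $y$. a) By changing the order and the signs, every such decomposition may be normalized to $p = a^2 + b^2$ with $a \equiv 1 \pmod 4$ and $b$ even. b) Let $p = a^2 + b^2$ with integers $a \equiv 1 \pmod 4$ and $b$ even. Then only the following eight possibilities can occur. i) $a \equiv 1, 9, 13$ or $17 \pmod{20}$ and $b \equiv 0 \pmod{20}$. In this case $5^{(p-1)/4} \equiv 1 \pmod p$, and $5$ is a quartic residue modulo $p$, i.e. $z^4 \equiv 5 \pmod p$ has an integer solution $z$. ii) $a \equiv 5 \pmod{20}$ and $b \equiv 4, 8, 12$ or $16 \pmod{20}$. In this case $5^{(p-1)/4} \equiv -1 \pmod p$, and $5$ is a quadratic but not a quartic residue modulo $p$, i.e. $z^2 \equiv 5 \pmod p$ has an integer solution, but $z^4 \equiv 5 \pmod p$ has none. -/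

import Mathlib

/-! Let s² = 5 in `ZMod p` and let χ be the quadratic character. Since 5^((p-1)/4) = χ(s),
everything reduces to `isSquare_sqrt_five_iff`: s is a square exactly when 5 ∣ b. Put i = b/a, so i²
= -1. The identity 2(1+s)(1+2i) = (s+1+2i)², with 2 a square and s(1+s) = 5+s, gives χ(s)χ(1+2i) =
χ(5+s). Jacobi reciprocity gives χ(1+2i) = J(a+2b | 5). Fifth roots of unity show that χ(5+s) = 1
exactly when p ≡ 1 (mod 5). Comparing residues modulo 5 finishes the proof. -/

open NumberTheorySymbols

/-! ### Uniqueness of the two-square decomposition. -/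

section TwoSquares

variable {p : ℕ}

/-- Since (xy')² - (x'y)² = p(x² - x'²), p divides xy' - x'y or xy' + x'y. By p² = (xx' + yy')² +
(xy' - x'y)², a multiple of p in the last square is 0 or ±p, and ±p forces xx' + yy' = 0. -/
theorem sq_eq_or_sq_eq_of_sq_add_sq_eq_prime (hp : p.Prime) {x y x' y' : ℤ}
    (h : (p : ℤ) = x ^ 2 + y ^ 2) (h' : (p : ℤ) = x' ^ 2 + y' ^ 2) :
    (x' ^ 2 = x ^ 2 ∧ y' ^ 2 = y ^ 2) ∨ (x' ^ 2 = y ^ 2 ∧ y' ^ 2 = x ^ 2) := by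
  have hp0 : (0 : ℤ) < p := by exact_mod_cast hp.pos
  have key : ∀ y' : ℤ, (p : ℤ) = x' ^ 2 + y' ^ 2 → (p : ℤ) ∣ x * y' - x' * y →
      (x' ^ 2 = x ^ 2 ∧ y' ^ 2 = y ^ 2) ∨ (x' ^ 2 = y ^ 2 ∧ y' ^ 2 = x ^ 2) := by
    rintro y' h' ⟨k, hk⟩
    have h1 : (p : ℤ) ^ 2 = (x * x' + y * y') ^ 2 + (p * k) ^ 2 := by
      rw [← hk]
      linear_combination (p + (x' ^ 2 + y' ^ 2) - (x' ^ 2 + y' ^ 2)) * h + (x ^ 2 + y ^ 2) * h'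
    rcases eq_or_ne k 0 with rfl | hk0
    · left
      have h2 : (p : ℤ) * (x' ^ 2 - x ^ 2) = 0 := by
        linear_combination x' ^ 2 * h - x ^ 2 * h' - (x * y' + x' * y) * hk
      have h3 : x' ^ 2 = x ^ 2 := by
        rcases mul_eq_zero.mp h2 with h2 | h2 <;> linarith
      exact ⟨h3, by linarith⟩
    · right
      have hk1 : 1 ≤ k ^ 2 := by
        have := sq_pos_of_ne_zero hk0; linarith
      have h2 : (x * x' + y * y') ^ 2 = 0 := by
        have := mul_le_mul_of_nonneg_left hk1 (sq_nonneg (p : ℤ))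
        have := sq_nonneg (x * x' + y * y')
        nlinarith
      have h2 : x * x' + y * y' = 0 := pow_eq_zero_iff two_ne_zero |>.mp h2
      have h3 : (p : ℤ) * (p - x ^ 2 - x' ^ 2) = 0 := by
        linear_combination (p - x' ^ 2) * h + y ^ 2 * h' - (x * x' - y * y') * h2
      rcases mul_eq_zero.mp h3 with h3 | h3
      · linarith
      · exact ⟨by linarith, by linarith⟩
  have hdvd : (p : ℤ) ∣ (x * y' - x' * y) * (x * y' + x' * y) :=
    ⟨x ^ 2 - x' ^ 2, by linear_combination x' ^ 2 * h - x ^ 2 * h'⟩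
  rcases (Nat.prime_iff_prime_int.mp hp).dvd_or_dvd hdvd with hd | hd
  · exact key y' h' hd
  · have := key (-y') (by rw [neg_sq]; exact h')
      (by rw [show x * -y' - x' * y = -(x * y' + x' * y) by ring]; exact hd.neg_right)
    simpa using this

end TwoSquares

/-! ### Reciprocity for a and a + 2b. -/

section QuarticResidue

variable {p : ℕ} [Fact p.Prime]

theorem legendreSym_eq_jacobiSym_natAbs (hp : p % 4 = 1) {n : ℤ} (hn : Odd n) :
    legendreSym p n = J(p | n.natAbs) := by
  have h : legendreSym p n = legendreSym p n.natAbs := by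
    rcases Int.natAbs_eq n with hn | hn
    · rw [← hn]
    · conv_lhs => rw [hn]
      rw [legendreSym.at_neg (by omega), ZMod.χ₄_nat_one_mod_four hp, one_mul]
  rw [h, jacobiSym.legendreSym.to_jacobiSym,
    jacobiSym.quadratic_reciprocity_one_mod_four' (Int.natAbs_odd.mpr hn) hp]

theorem isCoprime_of_prime_eq_sq_add_sq {a b : ℤ} (h : (p : ℤ) = a ^ 2 + b ^ 2) :
    IsCoprime a b := by
  have hp : p.Prime := Fact.out
  rw [Int.isCoprime_iff_gcd_eq_one]
  have h1 : ((Int.gcd a b : ℤ)) ^ 2 ∣ p := by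
    rw [h]
    exact dvd_add (pow_dvd_pow_of_dvd (Int.gcd_dvd_left ..) 2)
      (pow_dvd_pow_of_dvd (Int.gcd_dvd_right ..) 2)
  have h2 : Int.gcd a b ^ 2 ∣ p := by exact_mod_cast h1
  have := (Nat.squarefree_iff_prime_squarefree.mp hp.squarefree)
  by_contra hne
  obtain ⟨q, hq, hqd⟩ := Nat.exists_prime_and_dvd hne
  exact this q hq ((mul_dvd_mul hqd hqd).trans (by rwa [← sq]))

/-- After reciprocity, p ≡ b² modulo |a|, with b prime to a. -/
theorem legendreSym_odd_part (hp : p % 4 = 1) {a b : ℤ} (h : (p : ℤ) = a ^ 2 + b ^ 2)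
    (ha : Odd a) : legendreSym p a = 1 := by
  rw [legendreSym_eq_jacobiSym_natAbs hp ha]
  have hmod : (p : ℤ) % (a.natAbs : ℤ) = b ^ 2 % (a.natAbs : ℤ) := by
    refine Int.ModEq.symm (Int.modEq_iff_dvd.mpr ?_)
    rw [Int.natAbs_dvd]
    exact ⟨a, by linear_combination h⟩
  rw [jacobiSym.mod_left' hmod, jacobiSym.sq_one']
  have := Int.isCoprime_iff_gcd_eq_one.mp (isCoprime_of_prime_eq_sq_add_sq h).symm
  rwa [Int.gcd, Int.natAbs_natCast]

/-- From 5p = (a+2b)² + (2a-b)², 5p is a square modulo |a+2b|, so p and 5 have the same Jacobi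
symbol there. -/
theorem legendreSym_add_two_mul (hp : p % 4 = 1) {a b : ℤ} (h : (p : ℤ) = a ^ 2 + b ^ 2)
    (ha : Odd a) (h5 : ¬ (5 : ℤ) ∣ a + 2 * b) :
    legendreSym p (a + 2 * b) = J(a + 2 * b | 5) := by
  have hodd : Odd (a + 2 * b) := ha.add_even (even_two_mul b)
  rw [legendreSym_eq_jacobiSym_natAbs hp hodd]
  set n := (a + 2 * b).natAbs with hn
  have hnodd : Odd n := Int.natAbs_odd.mpr hodd
  have hcop : IsCoprime (2 * a - b) (a + 2 * b) := by
    obtain ⟨u, v, huv⟩ := isCoprime_of_prime_eq_sq_add_sq h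
    have h5c : IsCoprime 5 (a + 2 * b) :=
      ((Nat.prime_iff_prime_int.mp Nat.prime_five).coprime_iff_not_dvd).mpr h5
    obtain ⟨r, t, hrt⟩ := h5c
    exact ⟨r * (2 * u - v), t + r * (u + 2 * v), by linear_combination hrt + 5 * r * huv⟩
  have hmod : (5 * p : ℤ) % (n : ℤ) = (2 * a - b) ^ 2 % (n : ℤ) := by
    refine Int.ModEq.symm ((Int.modEq_iff_dvd).mpr ?_)
    rw [hn, Int.natAbs_dvd]
    exact ⟨a + 2 * b, by linear_combination 5 * h⟩
  have h1 : J(5 * p | n) = 1 := by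
    rw [jacobiSym.mod_left' hmod, jacobiSym.sq_one']
    have := Int.isCoprime_iff_gcd_eq_one.mp hcop
    rwa [Int.gcd, Int.natAbs_natCast]
  rw [jacobiSym.mul_left] at h1
  have h2 : J(p | n) = J((5 : ℕ) | n) := by
    rcases Int.mul_eq_one_iff_eq_one_or_neg_one.mp h1 with ⟨h, h'⟩ | ⟨h, h'⟩ <;>
    · rw [h']; exact_mod_cast h.symm
  rw [h2, jacobiSym.quadratic_reciprocity_one_mod_four (by norm_num) hnodd]
  rcases Int.natAbs_eq (a + 2 * b) with h | h
  · rw [hn, ← h]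
  · conv_rhs => rw [h]
    rw [jacobiSym.neg _ (by decide), ZMod.χ₄_nat_one_mod_four (by norm_num), one_mul]

/-! ### The quadratic character of 5 + √5. -/

theorem isSquare_five_add_of_five_dvd (hp : p % 4 = 1) (h5 : 5 ∣ p - 1) {s : ZMod p}
    (hs : s ^ 2 = 5) (h50 : (5 : ZMod p) ≠ 0) (h20 : (2 : ZMod p) ≠ 0)
    (h2 : IsSquare (2 : ZMod p)) : IsSquare (5 + s) := by
  have : Fact (Nat.Prime 5) := ⟨Nat.prime_five⟩
  have hneg : IsSquare (-1 : ZMod p) := ZMod.exists_sq_eq_neg_one_iff.mpr (by omega)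
  obtain ⟨u, hu⟩ := exists_prime_orderOf_dvd_card (G := (ZMod p)ˣ) 5 (by
    rw [ZMod.card_units]; exact h5)
  obtain ⟨z, hz⟩ : ∃ z : ZMod p, z = u := ⟨_, rfl⟩
  have hz5 : z ^ 5 = 1 := by
    rw [hz, ← Units.val_pow_eq_pow_val, ← hu, pow_orderOf_eq_one, Units.val_one]
  have hz1 : z - 1 ≠ 0 := by
    intro h
    have : u = 1 := Units.ext (by rw [← hz, Units.val_one]; linear_combination h)
    rw [this, orderOf_one] at hu
    omega
  have hz4 : z ^ 4 + z ^ 3 + z ^ 2 + z + 1 = 0 := by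
    refine (mul_eq_zero.mp ?_).resolve_left hz1
    linear_combination hz5
  -- The quadratic Gauss sum modulo 5, so t = ±s.
  set t := z + z ^ 4 - z ^ 2 - z ^ 3 with ht
  have ht2 : t ^ 2 = 5 := by
    rw [ht]
    linear_combination (z ^ 4 - 3 * z ^ 3 + z ^ 2 + 5 * z - 5) * hz4
  have hsq : 5 + t = -1 * 2 * (z - z ^ 4) ^ 2 := by
    rw [ht]
    linear_combination (2 * z ^ 4 - 2 * z ^ 3 - 4 * z + 5) * hz4
  have h5t : IsSquare (5 + t) := by
    rw [hsq]; exact (hneg.mul h2).mul (IsSquare.sq _)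
  have hst : (s - t) * (s + t) = 0 := by linear_combination hs - ht2
  rcases mul_eq_zero.mp hst with h | h
  · rwa [sub_eq_zero.mp h]
  · obtain ⟨w, hw⟩ := h5t
    have hw0 : w ≠ 0 := by
      rintro rfl
      apply h20
      apply (mul_eq_zero.mp (?_ : 2 * 2 * (5 : ZMod p) = 0)).elim
      · intro h; exact (mul_self_eq_zero.mp h)
      · intro h; exact absurd h h50
      · linear_combination (5 - t) * hw + ht2
    -- Here s = -t, and (5+s)(5-s) = 20 = (2s)².
    refine ⟨2 * s / w, ?_⟩
    field_simp
    linear_combination (-5 - s) * hw + (5 + s) * h - 5 * hs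

theorem five_dvd_of_isSquare_five_add (hp : p % 4 = 1) {s : ZMod p}
    (hs : s ^ 2 = 5) (h50 : (5 : ZMod p) ≠ 0) (h20 : (2 : ZMod p) ≠ 0)
    (h2 : IsSquare (2 : ZMod p)) (h : IsSquare (5 + s)) : 5 ∣ p - 1 := by
  have : Fact (Nat.Prime 5) := ⟨Nat.prime_five⟩
  obtain ⟨e, he⟩ : IsSquare (-1 : ZMod p) := ZMod.exists_sq_eq_neg_one_iff.mpr (by omega)
  obtain ⟨r, hr⟩ := h2
  obtain ⟨w, hw⟩ := h
  have hr0 : r ≠ 0 := by rintro rfl; simp at hr; exact h20 hr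
  -- c and d play the roles of z + z⁻¹ and z - z⁻¹ for a fifth root of unity z, where d² = c² - 4 =
  -- -(5+s)/2.
  obtain ⟨c, hc⟩ : ∃ c : ZMod p, 2 * c = s - 1 := ⟨(s - 1) / 2, by field_simp⟩
  obtain ⟨d, hd⟩ : ∃ d : ZMod p, r * d = e * w := ⟨e * w / r, by field_simp⟩
  obtain ⟨z, hz⟩ : ∃ z : ZMod p, 2 * z = c + d := ⟨(c + d) / 2, by field_simp⟩
  have hc2 : c ^ 2 + c - 1 = 0 := by
    refine (mul_eq_zero.mp (?_ : 2 * 2 * (c ^ 2 + c - 1) = 0)).resolve_left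
      (mul_ne_zero h20 h20)
    linear_combination (2 * c + s - 1 + 2) * hc + hs
  have hd2 : d ^ 2 = c ^ 2 - 4 := by
    refine mul_left_cancel₀ h20 ?_
    linear_combination (r * d + e * w) * hd + d ^ 2 * hr - w ^ 2 * he + hw + hc - 2 * hc2
  have hzc : z ^ 2 - c * z + 1 = 0 := by
    refine (mul_eq_zero.mp (?_ : 2 * 2 * (z ^ 2 - c * z + 1) = 0)).resolve_left
      (mul_ne_zero h20 h20)
    linear_combination (2 * z + (c + d) - 2 * c) * hz + hd2
  have hz4 : z ^ 4 + z ^ 3 + z ^ 2 + z + 1 = 0 := by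
    linear_combination (z ^ 2 + (c + 1) * z + 1) * hzc + z ^ 2 * hc2
  have hz5 : z ^ 5 = 1 := by linear_combination (z - 1) * hz4
  have hz1 : z ≠ 1 := by
    rintro rfl
    apply h50
    linear_combination hz4
  have hord : orderOf z = 5 := orderOf_eq_prime hz5 hz1
  rw [← hord]
  refine ZMod.orderOf_dvd_card_sub_one ?_
  rintro rfl
  simp at hz5

/-! ### The criterion for √5 to be a square modulo p. -/

theorem quadraticChar_sqrt_five_mul (h50 : (5 : ZMod p) ≠ 0)
    (h20 : (2 : ZMod p) ≠ 0) (h2 : IsSquare (2 : ZMod p)) {s i : ZMod p}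
    (hs : s ^ 2 = 5) (hi : i ^ 2 = -1) :
    quadraticChar (ZMod p) s * quadraticChar (ZMod p) (1 + 2 * i) =
      quadraticChar (ZMod p) (5 + s) := by
  have h1s : 1 + s ≠ 0 := by
    intro h
    apply mul_ne_zero h20 h20
    linear_combination (s - 1) * h - hs
  have h1i : 1 + 2 * i ≠ 0 := by
    intro h
    apply h50
    linear_combination (1 - 2 * i) * h + 4 * hi
  have hsq : quadraticChar (ZMod p) (2 * ((1 + s) * (1 + 2 * i))) = 1 :=
    (quadraticChar_one_iff_isSquare (mul_ne_zero h20 (mul_ne_zero h1s h1i))).mpr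
      ⟨s + 1 + 2 * i, by linear_combination -hs - 4 * hi⟩
  rw [map_mul, (quadraticChar_one_iff_isSquare h20).mpr h2, one_mul, map_mul] at hsq
  have heq : quadraticChar (ZMod p) (1 + s) = quadraticChar (ZMod p) (1 + 2 * i) := by
    rcases Int.mul_eq_one_iff_eq_one_or_neg_one.mp hsq with ⟨h, h'⟩ | ⟨h, h'⟩ <;> rw [h, h']
  rw [← heq, ← map_mul]
  congr 1
  linear_combination hs

theorem jacobiSym_five_of_emod {n : ℤ} :
    (n % 5 = 1 ∨ n % 5 = 4 → J(n | 5) = 1) ∧ (n % 5 = 2 ∨ n % 5 = 3 → J(n | 5) = -1) := by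
  rw [jacobiSym.mod_left]
  constructor <;> rintro (h | h) <;> simp only [Nat.cast_ofNat, h] <;> norm_num

theorem Int.emod_five_sq (n : ℤ) :
    n % 5 = 0 ∧ n ^ 2 % 5 = 0 ∨ (n % 5 = 1 ∨ n % 5 = 4) ∧ n ^ 2 % 5 = 1 ∨
      (n % 5 = 2 ∨ n % 5 = 3) ∧ n ^ 2 % 5 = 4 := by
  rcases (by omega : n % 5 = 0 ∨ n % 5 = 1 ∨ n % 5 = 2 ∨ n % 5 = 3 ∨ n % 5 = 4) with
    h | h | h | h | h <;> simp [pow_two, Int.mul_emod, h]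

theorem emod_five_of_eq_sq_add_sq {n a b : ℤ} (h5 : n % 5 = 1 ∨ n % 5 = 4)
    (h : n = a ^ 2 + b ^ 2) :
    (a % 5 = 0 ∧ ((b % 5 = 1 ∨ b % 5 = 4) ∧ n % 5 = 1 ∨
        (b % 5 = 2 ∨ b % 5 = 3) ∧ n % 5 = 4)) ∨
      (b % 5 = 0 ∧ ((a % 5 = 1 ∨ a % 5 = 4) ∧ n % 5 = 1 ∨
        (a % 5 = 2 ∨ a % 5 = 3) ∧ n % 5 = 4)) := by
  have ha := Int.emod_five_sq a
  have hb := Int.emod_five_sq b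
  generalize a ^ 2 = A at *
  generalize b ^ 2 = B at *
  omega

theorem isSquare_sqrt_five_iff (h8 : p % 8 = 1) (h5 : p % 5 = 1 ∨ p % 5 = 4) {a b : ℤ}
    (h : (p : ℤ) = a ^ 2 + b ^ 2) (ha : Odd a) {s : ZMod p} (hs : s ^ 2 = 5) :
    IsSquare s ↔ (5 : ℤ) ∣ b := by
  have hp : p.Prime := Fact.out
  have hp5 : ¬ p ∣ 5 := fun hd => by
    have := (Nat.prime_dvd_prime_iff_eq hp Nat.prime_five).mp hd
    omega
  have hp2 : ¬ p ∣ 2 := fun hd => by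
    have := (Nat.prime_dvd_prime_iff_eq hp Nat.prime_two).mp hd
    omega
  have h50 : (5 : ZMod p) ≠ 0 := fun h0 => hp5 ((ZMod.natCast_eq_zero_iff 5 p).mp (mod_cast h0))
  have h20 : (2 : ZMod p) ≠ 0 := fun h0 => hp2 ((ZMod.natCast_eq_zero_iff 2 p).mp (mod_cast h0))
  have h2 : IsSquare (2 : ZMod p) := (ZMod.exists_sq_eq_two_iff (by omega)).mpr (Or.inl h8)
  have hs0 : s ≠ 0 := by rintro rfl; apply h50; rw [← hs]; ring
  have hla := legendreSym_odd_part (by omega) h ha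
  have ha0 : (a : ZMod p) ≠ 0 := by
    intro h0
    rw [(legendreSym.eq_zero_iff p a).mpr h0] at hla
    omega
  have habp : (a : ZMod p) ^ 2 + (b : ZMod p) ^ 2 = 0 := by
    have := congrArg (Int.cast : ℤ → ZMod p) h
    push_cast at this
    rw [← this, ZMod.natCast_self]
  have hi : ((b : ZMod p) / a) ^ 2 = -1 := by
    field_simp
    linear_combination habp
  have hab := emod_five_of_eq_sq_add_sq (by omega) h
  have hJ : quadraticChar (ZMod p) (1 + 2 * ((b : ZMod p) / a)) = J(a + 2 * b | 5) := by
    rw [← legendreSym_add_two_mul (by omega) h ha (by omega), legendreSym,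
      show ((a + 2 * b : ℤ) : ZMod p) = a * (1 + 2 * ((b : ZMod p) / a)) by
        push_cast; field_simp, map_mul]
    rw [legendreSym] at hla
    rw [hla, one_mul]
  have hkey := quadraticChar_sqrt_five_mul h50 h20 h2 hs hi
  rw [hJ] at hkey
  have hχ1 : p % 5 = 1 → quadraticChar (ZMod p) (5 + s) = 1 := fun h1 =>
    (quadraticChar_one_iff_isSquare fun h0 => mul_ne_zero (mul_ne_zero h20 h20) h50
      (by linear_combination (5 - s) * h0 + hs)).mpr
      (isSquare_five_add_of_five_dvd (by omega) (by omega) hs h50 h20 h2)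
  have hχ4 : p % 5 = 4 → quadraticChar (ZMod p) (5 + s) = -1 := fun h1 =>
    quadraticChar_neg_one_iff_not_isSquare.mpr fun hsq => by
      have := five_dvd_of_isSquare_five_add (by omega) hs h50 h20 h2 hsq
      omega
  have hJ1 := (jacobiSym_five_of_emod (n := a + 2 * b)).1
  have hJ2 := (jacobiSym_five_of_emod (n := a + 2 * b)).2
  rw [← quadraticChar_one_iff_isSquare hs0]
  -- If 5 ∣ a then a + 2b ≡ 2b, and the nonresidue 2 flips the sign; if 5 ∣ b then a + 2b ≡ a.
  rcases hab with ⟨h0, ⟨h1, h2⟩ | ⟨h1, h2⟩⟩ | ⟨h0, ⟨h1, h2⟩ | ⟨h1, h2⟩⟩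
  · rw [hχ1 (by omega), hJ2 (by omega)] at hkey
    omega
  · rw [hχ4 (by omega), hJ1 (by omega)] at hkey
    omega
  · rw [hχ1 (by omega), hJ1 (by omega)] at hkey
    omega
  · rw [hχ4 (by omega), hJ2 (by omega)] at hkey
    omega

/-! ### Quartic character of 5. -/

theorem five_pow_eq_quadraticChar_sqrt (h8 : p % 8 = 1) {s : ZMod p} (hs : s ^ 2 = 5) :
    (5 : ZMod p) ^ ((p - 1) / 4) = quadraticChar (ZMod p) s := by
  rw [quadraticChar_eq_pow_of_char_ne_two' (by rw [ZMod.ringChar_zmod_n]; omega), ZMod.card,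
    ← hs, ← pow_mul]
  congr 1
  omega

theorem exists_sq_eq_five (h5 : p % 5 = 1 ∨ p % 5 = 4) (h2 : p ≠ 2) :
    ∃ s : ZMod p, s ^ 2 = 5 := by
  have : Fact (Nat.Prime 5) := ⟨Nat.prime_five⟩
  have hsq : IsSquare ((p : ℕ) : ZMod 5) := by
    rw [← ZMod.natCast_mod]
    rcases h5 with h | h <;> rw [h]
    · exact ⟨1, by norm_num⟩
    · exact ⟨2, by norm_num⟩
  obtain ⟨s, hs⟩ :=
    (ZMod.exists_sq_eq_prime_iff_of_mod_four_eq_one (p := 5) (q := p) (by norm_num) h2).mp hsq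
  exact ⟨s, by rw [sq, ← hs]; norm_num⟩

theorem exists_int_pow_modEq_five_iff {k : ℕ} :
    (∃ z : ℤ, z ^ k ≡ 5 [ZMOD p]) ↔ ∃ z : ZMod p, z ^ k = 5 := by
  constructor
  · rintro ⟨z, hz⟩
    exact ⟨z, by exact_mod_cast (ZMod.intCast_eq_intCast_iff _ _ p).mpr hz⟩
  · rintro ⟨z, hz⟩
    obtain ⟨n, rfl⟩ := ZMod.intCast_surjective z
    exact ⟨n, (ZMod.intCast_eq_intCast_iff _ _ p).mp (by exact_mod_cast hz)⟩

theorem five_pow_modEq_iff {k : ℕ} {c : ℤ} :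
    (5 : ℤ) ^ k ≡ c [ZMOD p] ↔ (5 : ZMod p) ^ k = c := by
  rw [← ZMod.intCast_eq_intCast_iff]
  push_cast
  rfl

theorem five_quartic_of_five_dvd_even_part (h8 : p % 8 = 1) (h5 : p % 5 = 1 ∨ p % 5 = 4)
    {a b : ℤ} (h : (p : ℤ) = a ^ 2 + b ^ 2) (ha : Odd a) (hb : (5 : ℤ) ∣ b) :
    (5 : ℤ) ^ ((p - 1) / 4) ≡ 1 [ZMOD p] ∧ ∃ z : ℤ, z ^ 4 ≡ 5 [ZMOD p] := by
  obtain ⟨s, hs⟩ := exists_sq_eq_five h5 (by omega)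
  obtain ⟨t, rfl⟩ := (isSquare_sqrt_five_iff h8 h5 h ha hs).mpr hb
  have hs0 : t * t ≠ 0 := by
    intro h0
    have h50 : (5 : ZMod p) = 0 := by rw [← hs, h0]; ring
    have := (Nat.prime_dvd_prime_iff_eq (Fact.out : p.Prime) Nat.prime_five).mp
      ((ZMod.natCast_eq_zero_iff 5 p).mp (mod_cast h50))
    omega
  rw [five_pow_modEq_iff, exists_int_pow_modEq_five_iff, five_pow_eq_quadraticChar_sqrt h8 hs,
    (quadraticChar_one_iff_isSquare hs0).mpr ⟨t, rfl⟩]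
  exact ⟨rfl, t, by rw [← hs]; ring⟩

theorem five_not_quartic_of_not_five_dvd_even_part (h8 : p % 8 = 1)
    (h5 : p % 5 = 1 ∨ p % 5 = 4) {a b : ℤ} (h : (p : ℤ) = a ^ 2 + b ^ 2) (ha : Odd a)
    (hb : ¬ (5 : ℤ) ∣ b) :
    (5 : ℤ) ^ ((p - 1) / 4) ≡ -1 [ZMOD p] ∧ (∃ z : ℤ, z ^ 2 ≡ 5 [ZMOD p]) ∧
      ¬ ∃ z : ℤ, z ^ 4 ≡ 5 [ZMOD p] := by
  obtain ⟨s, hs⟩ := exists_sq_eq_five h5 (by omega)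
  have hns := (isSquare_sqrt_five_iff h8 h5 h ha hs).not.mpr hb
  rw [five_pow_modEq_iff, exists_int_pow_modEq_five_iff, exists_int_pow_modEq_five_iff,
    five_pow_eq_quadraticChar_sqrt h8 hs, quadraticChar_neg_one_iff_not_isSquare.mpr hns]
  refine ⟨rfl, ⟨s, hs⟩, ?_⟩
  rintro ⟨z, hz⟩
  -- The criterion holds for either square root of 5, in particular for z².
  exact hb ((isSquare_sqrt_five_iff h8 h5 h ha (s := z * z) (by rw [← hz]; ring)).mp ⟨z, rfl⟩)

end QuarticResidue

/-! ### Assembly and residues modulo 20. -/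

theorem mainTheorem7 (p : ℕ) (hp : p.Prime) (h8 : (p : ℤ) ≡ 1 [ZMOD 8])
    (h5 : (p : ℤ) ≡ 1 [ZMOD 5] ∨ (p : ℤ) ≡ -1 [ZMOD 5]) :
    -- `p` is a sum of two squares
    (∃ x y : ℤ, (p : ℤ) = x ^ 2 + y ^ 2) ∧
    -- the decomposition is essentially unique (up to order and signs)
    (∀ x y x' y' : ℤ, (p : ℤ) = x ^ 2 + y ^ 2 → (p : ℤ) = x' ^ 2 + y' ^ 2 →
      ((x' = x ∨ x' = -x) ∧ (y' = y ∨ y' = -y)) ∨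
      ((x' = y ∨ x' = -y) ∧ (y' = x ∨ y' = -x))) ∧
    -- a) by a change of order and signs it may be normalized to `a ≡ 1 (mod 4)`, `b` even
    (∀ x y : ℤ, (p : ℤ) = x ^ 2 + y ^ 2 →
      ∃ a b : ℤ, (((a = x ∨ a = -x) ∧ (b = y ∨ b = -y)) ∨
          ((a = y ∨ a = -y) ∧ (b = x ∨ b = -x))) ∧
        (p : ℤ) = a ^ 2 + b ^ 2 ∧ a ≡ 1 [ZMOD 4] ∧ Even b) ∧
    -- b) the eight possibilities for a normalized decomposition
    (∀ a b : ℤ, (p : ℤ) = a ^ 2 + b ^ 2 → a ≡ 1 [ZMOD 4] → Even b →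
      (((a ≡ 1 [ZMOD 20] ∨ a ≡ 9 [ZMOD 20] ∨ a ≡ 13 [ZMOD 20] ∨ a ≡ 17 [ZMOD 20]) ∧
          b ≡ 0 [ZMOD 20]) ∨
        (a ≡ 5 [ZMOD 20] ∧
          (b ≡ 4 [ZMOD 20] ∨ b ≡ 8 [ZMOD 20] ∨ b ≡ 12 [ZMOD 20] ∨ b ≡ 16 [ZMOD 20]))) ∧
      -- i)
      ((a ≡ 1 [ZMOD 20] ∨ a ≡ 9 [ZMOD 20] ∨ a ≡ 13 [ZMOD 20] ∨ a ≡ 17 [ZMOD 20]) →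
          b ≡ 0 [ZMOD 20] →
        (5 : ℤ) ^ ((p - 1) / 4) ≡ 1 [ZMOD p] ∧
        ∃ z : ℤ, z ^ 4 ≡ 5 [ZMOD p]) ∧
      -- ii)
      (a ≡ 5 [ZMOD 20] →
          (b ≡ 4 [ZMOD 20] ∨ b ≡ 8 [ZMOD 20] ∨ b ≡ 12 [ZMOD 20] ∨ b ≡ 16 [ZMOD 20]) →
        (5 : ℤ) ^ ((p - 1) / 4) ≡ -1 [ZMOD p] ∧
        (∃ z : ℤ, z ^ 2 ≡ 5 [ZMOD p]) ∧
        ¬ ∃ z : ℤ, z ^ 4 ≡ 5 [ZMOD p])) := by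
  have : Fact p.Prime := ⟨hp⟩
  have h8' : p % 8 = 1 := by have := h8.eq; omega
  have h5' : p % 5 = 1 ∨ p % 5 = 4 := by
    rcases h5 with h | h
    · left; have := h.eq; omega
    · right; have := h.eq; omega
  refine ⟨?_, ?_, ?_, ?_⟩
  · obtain ⟨x, y, h⟩ := Nat.Prime.sq_add_sq (p := p) (by omega)
    exact ⟨x, y, by exact_mod_cast h.symm⟩
  · intro x y x' y' h h'
    simpa only [sq_eq_sq_iff_eq_or_eq_neg] using sq_eq_or_sq_eq_of_sq_add_sq_eq_prime hp h h'
  · have key : ∀ x y : ℤ, (p : ℤ) = x ^ 2 + y ^ 2 → Odd x → ∃ a : ℤ, (a = x ∨ a = -x) ∧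
        (p : ℤ) = a ^ 2 + y ^ 2 ∧ a ≡ 1 [ZMOD 4] ∧ Even y := by
      intro x y h hx
      have hy : Even y := by
        have hodd : Odd (p : ℤ) := by rw [Int.odd_iff]; omega
        rw [h] at hodd
        have := (Int.odd_add.mp hodd).mp hx.pow
        exact (Int.even_pow.mp this).1
      rw [Int.odd_iff] at hx
      rcases (by omega : x % 4 = 1 ∨ (-x) % 4 = 1) with h1 | h1
      · exact ⟨x, Or.inl rfl, h, h1, hy⟩
      · exact ⟨-x, Or.inr rfl, by rw [neg_sq]; exact h, h1, hy⟩
    intro x y h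
    rcases Int.even_or_odd x with hx | hx
    · have hy : Odd y := by
        have hodd : Odd (p : ℤ) := by rw [Int.odd_iff]; omega
        rw [h, add_comm] at hodd
        by_contra hy
        rw [Int.not_odd_iff_even] at hy
        exact Int.not_even_iff_odd.mpr hodd ((hy.pow_of_ne_zero two_ne_zero).add
          (hx.pow_of_ne_zero two_ne_zero))
      obtain ⟨a, ha, h1⟩ := key y x (by rw [h]; ring) hy
      exact ⟨a, x, Or.inr ⟨ha, Or.inl rfl⟩, h1⟩
    · obtain ⟨a, ha, h1⟩ := key x y h hx
      exact ⟨a, y, Or.inl ⟨ha, Or.inl rfl⟩, h1⟩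
  · intro a b h ha hb
    have ha4 : a % 4 = 1 := ha
    have hodd : Odd a := by rw [Int.odd_iff]; omega
    -- As a² ≡ 1 ≡ p (mod 8), b² is divisible by 8.
    have hb4 : b % 4 = 0 := by
      have hp8 : (p : ℤ) % 8 = ((a % 8) ^ 2 + (b % 8) ^ 2) % 8 := by
        rw [h]; simp [Int.add_emod, pow_two, Int.mul_emod]
      rw [Int.even_iff] at hb
      rcases (by omega : a % 8 = 1 ∨ a % 8 = 5) with h1 | h1 <;>
        rcases (by omega : b % 8 = 0 ∨ b % 8 = 2 ∨ b % 8 = 4 ∨ b % 8 = 6) with h2 | h2 | h2 | h2 <;>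
        · rw [h1, h2] at hp8
          norm_num at hp8
          omega
    have hab : (a % 5 = 0 ∧ b % 5 ≠ 0) ∨ (a % 5 ≠ 0 ∧ b % 5 = 0) := by
      have := emod_five_of_eq_sq_add_sq (by omega) h
      omega
    refine ⟨?_, fun _ hb0 => ?_, fun _ hb0 => ?_⟩
    · simp only [Int.ModEq]
      omega
    · exact five_quartic_of_five_dvd_even_part h8' h5' h hodd
        (by simp only [Int.ModEq] at hb0; omega)
    · exact five_not_quartic_of_not_five_dvd_even_part h8' h5' h hodd
        (by simp only [Int.ModEq] at hb0; omega)
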